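/- \textbf{Setting.} Let $K,N\ge 1$. A server has $N$ independent files $W_1,\dots,W_N$, each uniform on $2^F$ values ($F$ bits), and serves $K$ users through an error-free broadcast link. Using $\mathbf W=(W_1,\dots,W_N)$ and private randomness independent of the files and of the demands, it fills the cache $Z_k$ of each user $k$ before the demands are known; a cache has at most $MF$ bits. Then user $k$ privately tells the server its demand $d_k\in\{1,\dots,N\}$, where $d_1,\dots,d_K$ are i.i.d. with a common law that gives each file positive probability, and are independent of the files and the server's randomness. The server, knowing all of this, broadcasts a message $X$ of at most $RF$ bits. All auxiliary data that a user needs is counted as part of $Z_k$ or $X$. Such a scheme is a \emph{$(K,N)$ demand-private coded caching scheme} with memory $M$ and rate $R$ if for every user $k$ $$H(W_{d_k}\mid Z_k,d_k,X)=0\qquad\text{and}\qquad I\big((d_j)_{j\ne k}\,;\,d_k,Z_k,X\mid \mathbf W\big)=0 .$$ The pair $(M,R)$ is \emph{achievable} if for every $\varepsilon>0$ and all sufficiently large $F$ there is such a scheme with memory $M+\varepsilon$ and rate $R+\varepsilon$. Let $R^{p*}_{K,N}(M)$ be the minimum of all $R$ such that $(M,R)$ is achievable. \textbf{Theorem.}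 The memory-rate pair $$\left(\frac{1}{K(N-1)+1},\;N\Big(1-\frac{1}{K(N-1)+1}\Big)\right)$$ is achievable. Moreover, if $K\ge 2$ (or $N=1$), then for every $M\in\big[0,\frac{1}{K(N-1)+1}\big]$ the minimum $R^{p*}_{K,N}(M)$ exists and $$R^{p*}_{K,N}(M)=N(1-M),$$ and every $(K,N)$ demand-private coded caching scheme, of any file size $F\ge 1$, with memory $M$ and rate $R$ satisfies $R\ge N(1-M)$. -/

import Mathlib

namespace CodedCaching

section Entropy

variable {Ω α β γ : Type*} [Fintype Ω] [Fintype α] [Fintype β] [Fintype γ]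

open Classical in
/-- The probability that `X = x`, where the finite sample space `Ω` carries the probability mass
function `P`. -/
noncomputable def probEq (P : Ω → ℝ) (X : Ω → α) (x : α) : ℝ :=
  ∑ ω, if X ω = x then P ω else 0

/-- Shannon entropy `H(X)` of a random variable with finitely many values (in nats). -/
noncomputable def entropy (P : Ω → ℝ) (X : Ω → α) : ℝ :=
  ∑ x, Real.negMulLog (probEq P X x)

/-- Conditional entropy `H(X | Y) = H(X, Y) - H(Y)`. -/
noncomputable def condEntropy (P : Ω → ℝ) (X : Ω → α) (Y : Ω → β) : ℝ :=
  entropy P (fun ω => (X ω, Y ω)) - entropy P Y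

/-- Conditional mutual information
`I(X ; Y | V) = H(X | V) - H(X | Y, V)`. -/
noncomputable def condMutualInfo (P : Ω → ℝ) (X : Ω → α) (Y : Ω → β) (V : Ω → γ) : ℝ :=
  condEntropy P X V - condEntropy P X (fun ω => (Y ω, V ω))

end Entropy

/-- The contents of the `N` files, each of `F` bits. -/
abbrev Files (N F : ℕ) : Type := Fin N → Fin (2 ^ F)

/-- A demand vector: user `k` asks for file `d k`. -/
abbrev Demands (K N : ℕ) : Type := Fin K → Fin N

/-- A coded caching scheme with `K` users and `N` files of `F` bits each. The server may use private
randomness, drawn from `Rand` according to `randLaw` independently of the files and the demands.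
The cache contents are produced without knowledge of the demands, the broadcast message with
knowledge of everything the server has. Any auxiliary data that a user has to be given (keys,
headers) is part of its cache content or of the broadcast message. -/
structure CachingScheme (K N F : ℕ) where
  /-- values of the private randomness of the server -/
  Rand : Type
  /-- possible cache contents of a user -/
  Cache : Type
  /-- possible broadcast messages -/
  Msg : Type
  [fintypeRand : Fintype Rand]
  [fintypeCache : Fintype Cache]
  [fintypeMsg : Fintype Msg]
  randLaw : Rand → ℝ
  randLaw_nonneg : ∀ θ, 0 ≤ randLaw θ
  randLaw_sum : ∑ θ, randLaw θ = 1
  /-- placement phase: the cache content of each user -/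
  place : Fin K → Rand → Files N F → Cache
  /-- delivery phase: the broadcast message -/
  deliver : Rand → Files N F → Demands K N → Msg

attribute [instance] CachingScheme.fintypeRand CachingScheme.fintypeCache
  CachingScheme.fintypeMsg

namespace CachingScheme

variable {K N F : ℕ} (C : CachingScheme K N F)

/-- Sample space: server randomness, files, demands. -/
abbrev Sample : Type := C.Rand × Files N F × Demands K N

/-- Joint law: the server randomness, the files `W_n` (each uniform on `2 ^ F` values) and the
demands `d_k` (each with law `p`) are all independent. -/
noncomputable def law (p : Fin N → ℝ) (ω : C.Sample) : ℝ :=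
  C.randLaw ω.1 * (∏ _n : Fin N, (1 / 2 ^ F : ℝ)) * ∏ k, p (ω.2.2 k)

/-- The tuple `W` of all files. -/
def allFiles (ω : C.Sample) : Files N F := ω.2.1

/-- The demand `d_k` of user `k`. -/
def demand (k : Fin K) (ω : C.Sample) : Fin N := ω.2.2 k

/-- The demands of all users but `k`. -/
def otherDemands (k : Fin K) (ω : C.Sample) : {j : Fin K // j ≠ k} → Fin N := fun j => ω.2.2 j

/-- The file `W_{d_k}` that user `k` demands. -/
def demandedFile (k : Fin K) (ω : C.Sample) : Fin (2 ^ F) := ω.2.1 (ω.2.2 k)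

/-- The cache content `Z_k` of user `k`. -/
def cacheContent (k : Fin K) (ω : C.Sample) : C.Cache := C.place k ω.1 ω.2.1

/-- The broadcast message `X`. -/
def message (ω : C.Sample) : C.Msg := C.deliver ω.1 ω.2.1 ω.2.2

/-- Decodability: `H(W_{d_k} | Z_k, d_k, X) = 0` for every user `k`. -/
def IsDecodable (p : Fin N → ℝ) : Prop :=
  ∀ k : Fin K, condEntropy (C.law p) (C.demandedFile k)
    (fun ω => (C.cacheContent k ω, C.demand k ω, C.message ω)) = 0

/-- Demand privacy: `I(d_{-k} ; d_k, Z_k, X | W) = 0` for every user `k`, where `d_{-k}` are the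
demands of the other users. -/
def IsPrivate (p : Fin N → ℝ) : Prop :=
  ∀ k : Fin K, condMutualInfo (C.law p) (C.otherDemands k)
    (fun ω => (C.demand k ω, C.cacheContent k ω, C.message ω)) C.allFiles = 0

/-- Every cache holds at most `M * F` bits and the broadcast message has at most `R * F` bits. -/
def HasMemoryRate (M R : ℝ) : Prop :=
  (Fintype.card C.Cache : ℝ) ≤ (2 : ℝ) ^ (M * F) ∧ (Fintype.card C.Msg : ℝ) ≤ (2 : ℝ) ^ (R * F)

/-- `C` is a demand-private coded caching scheme with memory `M` and rate `R`. -/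
def IsDemandPrivateScheme (p : Fin N → ℝ) (M R : ℝ) : Prop :=
  C.IsDecodable p ∧ C.IsPrivate p ∧ C.HasMemoryRate M R

end CachingScheme

/-- The memory-rate pair `(M, R)` is achievable with demand privacy by `K` users and `N` files with
demand law `p`: up to an arbitrarily small excess in the normalized sizes, it is attained by
demand-private schemes for all sufficiently large file sizes. -/
def PrivatelyAchievable (K N : ℕ) (p : Fin N → ℝ) (M R : ℝ) : Prop :=
  ∀ ε : ℝ, 0 < ε → ∃ F₀ : ℕ, ∀ F : ℕ, F₀ ≤ F →
    ∃ C : CachingScheme K N F, C.IsDemandPrivateScheme p (M + ε) (R + ε)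

/-- `R` is the optimal demand-private rate `R^{p*}_{K,N}(M)`: the minimum of the rates that are
achievable with demand privacy at memory `M`. -/
def IsOptimalPrivateRate (K N : ℕ) (p : Fin N → ℝ) (M R : ℝ) : Prop :=
  IsLeast {R' : ℝ | PrivatelyAchievable K N p M R'} R

end CodedCaching

/-! Converse: fix a user `k` and files `w`. If `K ≥ 2`, privacy against another user says that,
given the message and the files, every demand of `k` is still possible. So one message is compatible
with `w` and with all `N` demands of `k`. This message and the corresponding `N` cache contents of
`k` determine `w`, whence `2 ^ (F * N) ≤ |Msg| * |Cache| ^ N` (`card_files_le`), and logarithms give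
`N ≤ R + N * M`.

Achievability: write each file as a `K × N` array with equal row sums, which has `K * (N - 1) + 1`
free entries. User `k` draws a secret column `S k` and caches the sum over all files of the entry
`(k, S k)`. The message reveals the shifts `q = d - S`, which are uniform and independent of the
demands. For each file `m` it also contains the array minus its row sum times the indicator of `s +
q k = m`. The result has zero row sums, so one subfile is saved. In the cached sum, only the row sum
of the demanded file is then unknown (`Subfiles.entry_eq`). -/

namespace CodedCaching

/-! ### Entropy, independence and determination on finite sample spaces -/

section Entropy

variable {Ω α β γ τ : Type*} [Fintype Ω]

theorem probEq_nonneg {P : Ω → ℝ} (hP : ∀ ω, 0 ≤ P ω) (X : Ω → α) (x : α) :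
    0 ≤ probEq P X x := by
  unfold probEq
  refine Finset.sum_nonneg fun ω _ => ?_
  split_ifs
  exacts [hP ω, le_rfl]

theorem sum_probEq [Fintype α] (P : Ω → ℝ) (X : Ω → α) : ∑ x, probEq P X x = ∑ ω, P ω := by
  classical
  unfold probEq
  rw [Finset.sum_comm]
  simp

theorem sum_probEq_pair_right [Fintype β] (P : Ω → ℝ) (X : Ω → α) (Y : Ω → β) (x : α) :
    ∑ y, probEq P (fun ω => (X ω, Y ω)) (x, y) = probEq P X x := by
  classical
  unfold probEq
  rw [Finset.sum_comm]
  simp [Prod.ext_iff, ite_and]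

theorem sum_probEq_pair_left [Fintype α] (P : Ω → ℝ) (X : Ω → α) (Y : Ω → β) (y : β) :
    ∑ x, probEq P (fun ω => (X ω, Y ω)) (x, y) = probEq P Y y := by
  classical
  unfold probEq
  rw [Finset.sum_comm]
  simp [Prod.ext_iff, ite_and]

theorem probEq_pos_iff {P : Ω → ℝ} (hP : ∀ ω, 0 ≤ P ω) (X : Ω → α) (x : α) :
    0 < probEq P X x ↔ ∃ ω, X ω = x ∧ 0 < P ω := by
  classical
  have hnn : ∀ ω ∈ Finset.univ, 0 ≤ (if X ω = x then P ω else 0) := fun ω _ => by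
    split_ifs
    exacts [hP ω, le_rfl]
  unfold probEq
  constructor
  · intro h
    obtain ⟨ω, -, hω⟩ := Finset.exists_lt_of_sum_lt
      (s := Finset.univ) (f := fun _ : Ω => (0 : ℝ)) (by simpa using h)
    by_cases hx : X ω = x
    · exact ⟨ω, hx, by simpa [hx] using hω⟩
    · simp [hx] at hω
  · rintro ⟨ω, hx, hω⟩
    refine lt_of_lt_of_le ?_ (Finset.single_le_sum hnn (Finset.mem_univ ω))
    simpa [hx] using hω

theorem probEq_pair_le_left [Finite β] {P : Ω → ℝ} (hP : ∀ ω, 0 ≤ P ω) (X : Ω → α) (Y : Ω → β)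
    (x : α) (y : β) : probEq P (fun ω => (X ω, Y ω)) (x, y) ≤ probEq P X x := by
  have := Fintype.ofFinite β
  rw [← sum_probEq_pair_right P X Y x]
  exact Finset.single_le_sum (f := fun y => probEq P (fun ω => (X ω, Y ω)) (x, y))
    (fun _ _ => probEq_nonneg hP _ _) (Finset.mem_univ y)

theorem probEq_pair_le_right [Finite α] {P : Ω → ℝ} (hP : ∀ ω, 0 ≤ P ω) (X : Ω → α) (Y : Ω → β)
    (x : α) (y : β) : probEq P (fun ω => (X ω, Y ω)) (x, y) ≤ probEq P Y y := by
  have := Fintype.ofFinite α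
  rw [← sum_probEq_pair_left P X Y y]
  exact Finset.single_le_sum (f := fun x => probEq P (fun ω => (X ω, Y ω)) (x, y))
    (fun _ _ => probEq_nonneg hP _ _) (Finset.mem_univ x)

/-- Independence of two random variables with finitely many values. -/
def Indep (P : Ω → ℝ) (X : Ω → α) (Y : Ω → β) : Prop :=
  ∀ x y, probEq P (fun ω => (X ω, Y ω)) (x, y) = probEq P X x * probEq P Y y

theorem Indep.entropy_pair [Fintype α] [Fintype β] {P : Ω → ℝ} (hP1 : ∑ ω, P ω = 1) {X : Ω → α} {Y : Ω → β}
    (h : Indep P X Y) :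
    entropy P (fun ω => (X ω, Y ω)) = entropy P X + entropy P Y := by
  unfold entropy
  rw [Fintype.sum_prod_type]
  simp_rw [h _ _, Real.negMulLog_mul, Finset.sum_add_distrib, ← Finset.mul_sum,
    ← Finset.sum_mul, sum_probEq, hP1, one_mul]

/-- Equality in the subadditivity of entropy forces independence. -/
theorem indep_of_entropy_pair [Fintype α] [Fintype β] {P : Ω → ℝ} (hP : ∀ ω, 0 ≤ P ω) (hP1 : ∑ ω, P ω = 1)
    {X : Ω → α} {Y : Ω → β}
    (h : entropy P (fun ω => (X ω, Y ω)) = entropy P X + entropy P Y) : Indep P X Y := by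
  set j : α → β → ℝ := fun x y => probEq P (fun ω => (X ω, Y ω)) (x, y) with hj
  set a : α → ℝ := probEq P X with ha
  set b : β → ℝ := probEq P Y with hb
  -- These terms sum to the divergence of the joint law from the product of its marginals. They are
  -- nonnegative, so a zero sum kills each one, and `klFun` vanishes only at `1`.
  have hterm : ∀ x y, a x * b y * InformationTheory.klFun (j x y / (a x * b y)) =
      -Real.negMulLog (j x y) - j x y * Real.log (a x) - j x y * Real.log (b y)
        + a x * b y - j x y := by
    intro x y
    have hj0 : 0 ≤ j x y := probEq_nonneg hP _ _
    have hja : j x y ≤ a x := probEq_pair_le_left hP X Y x y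
    have hjb : j x y ≤ b y := probEq_pair_le_right hP X Y x y
    rcases hj0.eq_or_lt with h0 | h0
    · simp [← h0, InformationTheory.klFun]
    · have hax : 0 < a x := h0.trans_le hja
      have hby : 0 < b y := h0.trans_le hjb
      rw [InformationTheory.klFun, Real.log_div h0.ne' (mul_pos hax hby).ne',
        Real.log_mul hax.ne' hby.ne', Real.negMulLog]
      field_simp
      ring
  have hsum : ∑ x, ∑ y, a x * b y * InformationTheory.klFun (j x y / (a x * b y)) = 0 := by
    have e1 : ∑ x, ∑ y, Real.negMulLog (j x y) = entropy P (fun ω => (X ω, Y ω)) := by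
      rw [entropy, Fintype.sum_prod_type]
    have e2 : ∑ x, ∑ y, j x y * Real.log (a x) = -entropy P X := by
      simp_rw [← Finset.sum_mul, hj, sum_probEq_pair_right, entropy, Real.negMulLog]
      simp [ha]
    have e3 : ∑ x, ∑ y, j x y * Real.log (b y) = -entropy P Y := by
      rw [Finset.sum_comm]
      simp_rw [← Finset.sum_mul, hj, sum_probEq_pair_left, entropy, Real.negMulLog]
      simp [hb]
    have e4 : ∑ x, ∑ y, a x * b y = 1 := by
      simp_rw [← Finset.mul_sum, ← Finset.sum_mul, ha, hb, sum_probEq, hP1, one_mul]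
    have e5 : ∑ x, ∑ y, j x y = 1 := by
      simp_rw [hj, sum_probEq_pair_right, sum_probEq, hP1]
    simp_rw [hterm, Finset.sum_sub_distrib, Finset.sum_add_distrib, Finset.sum_sub_distrib,
      Finset.sum_neg_distrib]
    rw [e1, e2, e3, e4, e5, h]
    ring
  have hnn : ∀ x y, 0 ≤ a x * b y * InformationTheory.klFun (j x y / (a x * b y)) := by
    intro x y
    have hab : 0 ≤ a x * b y := mul_nonneg (probEq_nonneg hP _ _) (probEq_nonneg hP _ _)
    exact mul_nonneg hab
      (InformationTheory.klFun_nonneg (div_nonneg (probEq_nonneg hP _ _) hab))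
  intro x y
  have hz : a x * b y * InformationTheory.klFun (j x y / (a x * b y)) = 0 := by
    have h1 := (Finset.sum_eq_zero_iff_of_nonneg
      (fun x _ => Finset.sum_nonneg fun y _ => hnn x y)).1 hsum x (Finset.mem_univ x)
    exact (Finset.sum_eq_zero_iff_of_nonneg (fun y _ => hnn x y)).1 h1 y (Finset.mem_univ y)
  have hab : 0 ≤ a x * b y := mul_nonneg (probEq_nonneg hP _ _) (probEq_nonneg hP _ _)
  have hj0 : 0 ≤ j x y := probEq_nonneg hP _ _
  -- Where a marginal vanishes, `klFun` gives no information, but the joint law is dominated by that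
  -- marginal.
  rcases mul_eq_zero.1 hz with h0 | h0
  · have hj00 : j x y = 0 := by
      rcases mul_eq_zero.1 h0 with h1 | h1
      · exact le_antisymm (h1 ▸ probEq_pair_le_left hP X Y x y) hj0
      · exact le_antisymm (h1 ▸ probEq_pair_le_right hP X Y x y) hj0
    exact hj00.trans h0.symm
  · rw [InformationTheory.klFun_eq_zero_iff (div_nonneg hj0 hab)] at h0
    exact eq_of_div_eq_one h0

/-- A random variable with vanishing conditional entropy given `V` is determined by `V` on the
support. -/
theorem eq_of_condEntropy_eq_zero [Fintype α] [Fintype β] {P : Ω → ℝ} (hP : ∀ ω, 0 ≤ P ω) {U : Ω → α} {V : Ω → β}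
    (h : condEntropy P U V = 0) {ω ω' : Ω} (hω : 0 < P ω) (hω' : 0 < P ω')
    (hV : V ω = V ω') : U ω = U ω' := by
  set j : α → β → ℝ := fun x y => probEq P (fun ω => (U ω, V ω)) (x, y) with hj
  set b : β → ℝ := probEq P V with hb
  -- `H(U | V)` is the sum of these nonnegative terms, so wherever `j u v` is positive it equals the
  -- whole mass `b v`.
  have hnn : ∀ u v, 0 ≤ j u v * (Real.log (b v) - Real.log (j u v)) := by
    intro u v
    have hj0 : 0 ≤ j u v := probEq_nonneg hP _ _
    rcases hj0.eq_or_lt with h0 | h0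
    · simp [← h0]
    · exact mul_nonneg hj0 (sub_nonneg.2
        (Real.log_le_log h0 (probEq_pair_le_right hP U V u v)))
  have hsum : ∑ u, ∑ v, j u v * (Real.log (b v) - Real.log (j u v)) = 0 := by
    have e1 : ∑ u, ∑ v, j u v * Real.log (j u v) = -entropy P (fun ω => (U ω, V ω)) := by
      rw [entropy, Fintype.sum_prod_type]
      simp [Real.negMulLog, hj]
    have e2 : ∑ u, ∑ v, j u v * Real.log (b v) = -entropy P V := by
      rw [Finset.sum_comm]
      simp_rw [← Finset.sum_mul, hj, sum_probEq_pair_left, entropy, Real.negMulLog]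
      simp [hb]
    simp_rw [mul_sub, Finset.sum_sub_distrib]
    rw [e1, e2]
    unfold condEntropy at h
    linarith
  have hz : ∀ u v, j u v * (Real.log (b v) - Real.log (j u v)) = 0 := by
    intro u v
    have h1 := (Finset.sum_eq_zero_iff_of_nonneg
      (fun u _ => Finset.sum_nonneg fun v _ => hnn u v)).1 hsum u (Finset.mem_univ u)
    exact (Finset.sum_eq_zero_iff_of_nonneg (fun v _ => hnn u v)).1 h1 v (Finset.mem_univ v)
  by_contra hne
  have hp : 0 < j (U ω) (V ω) := (probEq_pos_iff hP _ _).2 ⟨ω, rfl, hω⟩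
  have hp' : 0 < j (U ω') (V ω) := (probEq_pos_iff hP _ _).2 ⟨ω', by rw [hV], hω'⟩
  have hb0 : 0 < b (V ω) := hp.trans_le (probEq_pair_le_right hP U V _ _)
  have heq : b (V ω) = j (U ω) (V ω) := by
    have := (mul_eq_zero.1 (hz (U ω) (V ω))).resolve_left hp.ne'
    exact Real.log_injOn_pos hb0 hp (sub_eq_zero.1 this)
  have hle : j (U ω) (V ω) + j (U ω') (V ω) ≤ b (V ω) := by
    classical
    rw [hb, ← sum_probEq_pair_left P U V (V ω),
      ← Finset.sum_pair (f := fun u => j u (V ω)) hne]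
    exact Finset.sum_le_sum_of_subset_of_nonneg (Finset.subset_univ _)
      fun _ _ _ => probEq_nonneg hP _ _
  linarith

/-- Above each value of `V` a single value of `U` carries all the mass, so pairing with `U` does not
change the entropy. -/
theorem condEntropy_eq_zero_of_factors [Fintype α] [Fintype β] {P : Ω → ℝ} {U : Ω → α} {V : Ω → β}
    (h : ∀ ω ω', V ω = V ω' → U ω = U ω') : condEntropy P U V = 0 := by
  classical
  have key : ∀ v, ∑ u, Real.negMulLog (probEq P (fun ω => (U ω, V ω)) (u, v)) =
      Real.negMulLog (probEq P V v) := by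
    intro v
    by_cases hv : ∃ ω, V ω = v
    · obtain ⟨ω₀, rfl⟩ := hv
      rw [Finset.sum_eq_single (U ω₀)]
      · congr 1
        unfold probEq
        refine Finset.sum_congr rfl fun ω _ => ?_
        by_cases hω : V ω = V ω₀
        · simp [hω, h _ _ hω]
        · simp [hω]
      · intro u _ hu
        have : probEq P (fun ω => (U ω, V ω)) (u, V ω₀) = 0 := by
          unfold probEq
          refine Finset.sum_eq_zero fun ω _ => if_neg ?_
          rintro hω
          simp only [Prod.mk.injEq] at hω
          exact hu (hω.1.symm.trans (h _ _ hω.2))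
        simp [this]
      · simp
    · have h0 : probEq P V v = 0 :=
        Finset.sum_eq_zero fun ω _ => if_neg fun hω => hv ⟨ω, hω⟩
      have h1 : ∀ u, probEq P (fun ω => (U ω, V ω)) (u, v) = 0 := fun u =>
        Finset.sum_eq_zero fun ω _ => if_neg fun hω => hv ⟨ω, (Prod.mk.inj hω).2⟩
      simp [h0, h1]
  unfold condEntropy entropy
  rw [Fintype.sum_prod_type, Finset.sum_comm]
  simp_rw [key]
  exact sub_self _

/-- Functions of the two factors of a product distribution are independent. -/
theorem indep_of_equiv_prod [Fintype α] [Fintype τ] {P : Ω → ℝ} (φ : Ω ≃ α × τ) (p₁ : α → ℝ) (p₂ : τ → ℝ)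
    (hP : ∀ ω, P ω = p₁ (φ ω).1 * p₂ (φ ω).2) (h₁ : ∑ e, p₁ e = 1) (h₂ : ∑ t, p₂ t = 1)
    (g : τ → β) : Indep P (fun ω => (φ ω).1) (fun ω => g (φ ω).2) := by
  classical
  have hsum : ∀ f : α × τ → ℝ, ∑ ω, f (φ ω) = ∑ e, ∑ t, f (e, t) := fun f => by
    rw [Equiv.sum_comp φ f, Fintype.sum_prod_type]
  intro x y
  have e1 : probEq P (fun ω => (φ ω).1) x = p₁ x := by
    unfold probEq
    simp_rw [hP]
    rw [hsum (fun et => if et.1 = x then p₁ et.1 * p₂ et.2 else 0)]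
    simp only [Finset.sum_ite_irrel, Finset.sum_const_zero]
    simp [← Finset.mul_sum, h₂]
  have e2 : probEq P (fun ω => g (φ ω).2) y = ∑ t, if g t = y then p₂ t else 0 := by
    unfold probEq
    simp_rw [hP]
    rw [hsum (fun et => if g et.2 = y then p₁ et.1 * p₂ et.2 else 0), Finset.sum_comm]
    simp only [Finset.sum_ite_irrel, Finset.sum_const_zero, ← Finset.sum_mul, h₁, one_mul]
  rw [e1, e2]
  unfold probEq
  simp_rw [hP]
  rw [hsum (fun et => if (et.1, g et.2) = (x, y) then p₁ et.1 * p₂ et.2 else 0)]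
  simp only [Prod.mk.injEq, ite_and, Finset.sum_ite_irrel, Finset.sum_const_zero,
    Finset.sum_ite_eq', Finset.mem_univ, if_true, Finset.mul_sum, mul_ite, mul_zero]

theorem Indep.condMutualInfo_eq_zero [Fintype α] [Fintype β] [Fintype γ] {P : Ω → ℝ}
    (hP1 : ∑ ω, P ω = 1) {X : Ω → α} {Y : Ω → β}
    {V : Ω → γ} (h : Indep P X (fun ω => (Y ω, V ω))) (hV : Indep P X V) :
    condMutualInfo P X Y V = 0 := by
  unfold condMutualInfo condEntropy
  rw [h.entropy_pair hP1, hV.entropy_pair hP1]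
  ring

theorem indep_of_condMutualInfo_eq_zero [Fintype α] [Fintype β] [Fintype γ] {P : Ω → ℝ}
    (hP : ∀ ω, 0 ≤ P ω) (hP1 : ∑ ω, P ω = 1)
    {X : Ω → α} {Y : Ω → β} {V : Ω → γ} (hV : Indep P X V)
    (h : condMutualInfo P X Y V = 0) : Indep P X (fun ω => (Y ω, V ω)) := by
  refine indep_of_entropy_pair hP hP1 ?_
  unfold condMutualInfo condEntropy at h
  rw [hV.entropy_pair hP1] at h
  linarith

end Entropy

/-! ### The law of a scheme and the converse bound -/

theorem sum_prod_demands {κ : Type*} [Fintype κ] [DecidableEq κ] {N : ℕ} {p : Fin N → ℝ}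
    (hp : ∑ i, p i = 1) :
    ∑ d : κ → Fin N, ∏ k, p (d k) = 1 := by
  rw [← Fintype.prod_sum (fun (_ : κ) i => p i)]
  simp [hp]

theorem sum_mul_mul_triple {α β γ : Type*} [Fintype α] [Fintype β] [Fintype γ]
    (f : α → ℝ) (g : β → ℝ) (h : γ → ℝ) :
    ∑ t : α × β × γ, f t.1 * g t.2.1 * h t.2.2 = (∑ a, f a) * (∑ b, g b) * ∑ c, h c := by
  simp only [Fintype.sum_prod_type, ← Finset.mul_sum, ← Finset.sum_mul]

theorem sum_uniform_files (N F : ℕ) :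
    ∑ _w : Files N F, ∏ _n : Fin N, (1 / 2 ^ F : ℝ) = 1 := by
  simp

theorem prod_demands_split {K N : ℕ} (p : Fin N → ℝ) (k : Fin K) (d : Demands K N) :
    ∏ j, p (d j) = (∏ j : {j : Fin K // j ≠ k}, p (d j)) * p (d k) := by
  rw [Fintype.prod_eq_mul_prod_subtype_ne _ k, mul_comm]

namespace CachingScheme

variable {K N F : ℕ} (C : CachingScheme K N F) {p : Fin N → ℝ}

theorem law_nonneg (hp : ∀ i, 0 < p i) (ω : C.Sample) : 0 ≤ C.law p ω := by
  unfold law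
  have h1 := C.randLaw_nonneg ω.1
  have h2 : 0 ≤ ∏ k, p (ω.2.2 k) := Finset.prod_nonneg fun k _ => (hp _).le
  positivity

theorem law_pos (hp : ∀ i, 0 < p i) {ω : C.Sample} (h : 0 < C.randLaw ω.1) :
    0 < C.law p ω := by
  unfold law
  have h2 : 0 < ∏ k, p (ω.2.2 k) := Finset.prod_pos fun k _ => hp _
  positivity

theorem law_sum (hp : ∑ i, p i = 1) : ∑ ω, C.law p ω = 1 := by
  refine (sum_mul_mul_triple C.randLaw (fun _ : Files N F => ∏ _n : Fin N, (1 / 2 ^ F : ℝ))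
    (fun d : Demands K N => ∏ k, p (d k))).trans ?_
  rw [C.randLaw_sum, sum_uniform_files, sum_prod_demands hp, one_mul, one_mul]

/-- Separates the demands of the other users from the rest of the sample. -/
def splitDemand (k : Fin K) :
    C.Sample ≃ ({j : Fin K // j ≠ k} → Fin N) × (C.Rand × Files N F × Fin N) where
  toFun ω := (fun j => ω.2.2 j, (ω.1, ω.2.1, ω.2.2 k))
  invFun et := (et.2.1, et.2.2.1, (Equiv.funSplitAt k (Fin N)).symm (et.2.2.2, et.1))
  left_inv ω := by
    have := (Equiv.funSplitAt k (Fin N)).symm_apply_apply ω.2.2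
    simp only [Equiv.funSplitAt_apply] at this
    simp only [this]
  right_inv et := by
    have := (Equiv.funSplitAt k (Fin N)).apply_symm_apply (et.2.2.2, et.1)
    rw [Equiv.funSplitAt_apply, Prod.mk.injEq] at this
    simp only [this.1, this.2]

/-- This turns privacy, which is conditional on the files, into unconditional independence of the
other demands from the user's view together with the files, and back. -/
theorem indep_otherDemands_allFiles (hp : ∑ i, p i = 1) (k : Fin K) :
    Indep (C.law p) (C.otherDemands k) C.allFiles := by
  refine indep_of_equiv_prod (C.splitDemand k) (fun e => ∏ j, p (e j))
    (fun t => C.randLaw t.1 * (∏ _n : Fin N, (1 / 2 ^ F : ℝ)) * p t.2.2) (fun ω => ?_)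
    (sum_prod_demands hp) ?_ (fun t => t.2.1)
  · simp only [law, splitDemand, Equiv.coe_fn_mk, prod_demands_split p k]
    ring
  · refine (sum_mul_mul_triple C.randLaw
      (fun _ : Files N F => ∏ _n : Fin N, (1 / 2 ^ F : ℝ)) p).trans ?_
    rw [C.randLaw_sum, sum_uniform_files, hp, one_mul, one_mul]

/-- By privacy, some message is compatible with given files and every possible demand of
user `k`. -/
theorem exists_message (hp_pos : ∀ i, 0 < p i) (hp_sum : ∑ i, p i = 1) (hpriv : C.IsPrivate p)
    (hKN : 2 ≤ K ∨ N = 1) (k : Fin K) (w : Files N F) :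
    ∃ x : C.Msg, ∀ n : Fin N, ∃ ω : C.Sample,
      0 < C.law p ω ∧ C.message ω = x ∧ C.allFiles ω = w ∧ C.demand k ω = n := by
  obtain ⟨θ, hθ⟩ : ∃ θ, 0 < C.randLaw θ := by
    by_contra! hcon
    have := Finset.sum_nonpos fun θ (_ : θ ∈ Finset.univ) => hcon θ
    linarith [C.randLaw_sum]
  rcases isEmpty_or_nonempty (Fin N) with hN | ⟨⟨n₀⟩⟩
  · simp at hp_sum
  set ω₀ : C.Sample := (θ, w, fun _ => n₀) with hω₀
  have hpos₀ : 0 < C.law p ω₀ := C.law_pos hp_pos hθ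
  refine ⟨C.message ω₀, fun n => ?_⟩
  rcases hKN with hK | hN
  · have : Nontrivial (Fin K) := Fin.nontrivial_iff_two_le.2 hK
    -- The privacy condition used is that of `k'`: the demand of `k` is among those hidden from
    -- `k'`.
    obtain ⟨k', hk'⟩ := exists_ne k
    have hind := indep_of_condMutualInfo_eq_zero (C.law_nonneg hp_pos) (C.law_sum hp_sum)
      (C.indep_otherDemands_allFiles hp_sum k') (hpriv k')
    have h1 : 0 < probEq (C.law p) (C.otherDemands k') (fun _ => n) :=
      (probEq_pos_iff (C.law_nonneg hp_pos) _ _).2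
        ⟨(θ, w, fun _ => n), rfl, C.law_pos hp_pos hθ⟩
    have h2 := (probEq_pos_iff (C.law_nonneg hp_pos) (fun ω =>
      ((C.demand k' ω, C.cacheContent k' ω, C.message ω), C.allFiles ω)) _).2 ⟨ω₀, rfl, hpos₀⟩
    have h3 := mul_pos h1 h2
    rw [← hind, probEq_pos_iff (C.law_nonneg hp_pos)] at h3
    obtain ⟨ω, hω, hpos⟩ := h3
    simp only [Prod.mk.injEq] at hω
    exact ⟨ω, hpos, hω.2.1.2.2, hω.2.2, congrFun hω.1 ⟨k, hk'.symm⟩⟩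
  · subst hN
    exact ⟨ω₀, hpos₀, rfl, rfl, Subsingleton.elim _ _⟩

/-- The samples for different demands of user `k` may use different server randomness and other
demands. Only their message and files agree, which suffices to decode the files one by one. -/
theorem card_files_le (hK : 1 ≤ K) (hp_pos : ∀ i, 0 < p i) (hp_sum : ∑ i, p i = 1)
    (hKN : 2 ≤ K ∨ N = 1) (hdec : C.IsDecodable p) (hpriv : C.IsPrivate p) :
    (2 ^ F) ^ N ≤ Fintype.card C.Msg * Fintype.card C.Cache ^ N := by
  classical
  let k : Fin K := ⟨0, hK⟩
  choose x hx using fun w => C.exists_message hp_pos hp_sum hpriv hKN k w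
  choose ω hpos hmsg hfiles hdem using hx
  have hinj : Function.Injective
      (fun w : Files N F => (x w, fun n : Fin N => C.cacheContent k (ω w n))) := by
    intro w w' h
    simp only [Prod.mk.injEq] at h
    funext n
    have hV := eq_of_condEntropy_eq_zero (C.law_nonneg hp_pos) (hdec k) (hpos w n) (hpos w' n)
      (by rw [congrFun h.2 n, hdem, hdem, hmsg, hmsg, h.1])
    have e : ∀ w, C.demandedFile k (ω w n) = w n := fun w => by
      have h1 : C.demandedFile k (ω w n) = C.allFiles (ω w n) (C.demand k (ω w n)) := rfl
      rw [h1, hfiles, hdem]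
    rwa [e, e] at hV
  simpa using Fintype.card_le_of_injective _ hinj

theorem rate_lower_bound (hK : 1 ≤ K) (hp_pos : ∀ i, 0 < p i) (hp_sum : ∑ i, p i = 1)
    (hKN : 2 ≤ K ∨ N = 1) (hF : 1 ≤ F) {M R : ℝ} (h : C.IsDemandPrivateScheme p M R) :
    (N : ℝ) * (1 - M) ≤ R := by
  obtain ⟨hdec, hpriv, hM, hR⟩ := h
  have hcard : ((2 : ℝ) ^ F) ^ N ≤ Fintype.card C.Msg * (Fintype.card C.Cache : ℝ) ^ N :=
    mod_cast C.card_files_le hK hp_pos hp_sum hKN hdec hpriv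
  have h1 : (2 : ℝ) ^ ((F : ℝ) * N) ≤ (2 : ℝ) ^ (R * F + M * F * N) := by
    calc (2 : ℝ) ^ ((F : ℝ) * N) = ((2 : ℝ) ^ F) ^ N := by
          rw [Real.rpow_mul_natCast zero_le_two, Real.rpow_natCast]
      _ ≤ _ := hcard
      _ ≤ (2 : ℝ) ^ (R * F) * ((2 : ℝ) ^ (M * F)) ^ N := by gcongr
      _ = _ := by rw [Real.rpow_add two_pos, Real.rpow_mul_natCast zero_le_two (M * F)]
  have h2 : (F : ℝ) * N ≤ R * F + M * F * N :=
    (Real.rpow_le_rpow_left_iff one_lt_two).1 h1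
  have hF' : (0 : ℝ) < F := by exact_mod_cast hF
  refine le_of_mul_le_mul_right ?_ hF'
  linarith

end CachingScheme

theorem PrivatelyAchievable.rate_lower_bound {K N : ℕ} (hK : 1 ≤ K) {p : Fin N → ℝ}
    (hp_pos : ∀ i, 0 < p i) (hp_sum : ∑ i, p i = 1) (hKN : 2 ≤ K ∨ N = 1) {M R : ℝ}
    (h : PrivatelyAchievable K N p M R) : (N : ℝ) * (1 - M) ≤ R := by
  refine le_of_forall_pos_le_add fun δ hδ => ?_
  -- Excess `ε` in both memory and rate weakens the bound by `(N + 1) * ε`. The file size `F₀ + 1`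
  -- below ensures `1 ≤ F`.
  have hN1 : (0 : ℝ) < N + 1 := by positivity
  obtain ⟨F₀, hF₀⟩ := h (δ / (N + 1)) (by positivity)
  obtain ⟨C, hC⟩ := hF₀ (F₀ + 1) (by omega)
  have h1 := C.rate_lower_bound hK hp_pos hp_sum hKN (by omega) hC
  have h2 : δ / ((N : ℝ) + 1) * (N + 1) = δ := by field_simp
  nlinarith

/-! ### The scheme with randomly chosen virtual users -/

section Scheme

variable {K n F : ℕ} {A B : Type} [AddCommGroup A]

/-- The subfiles of a file: a common row sum, and all columns but the first of an array with `K`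
rows, `n + 1` columns and that row sum. -/
abbrev Subfiles (K n : ℕ) (A : Type) : Type :=
  A × (Fin K → {s : Fin (n + 1) // s ≠ 0} → A)

/-- The entries of the array with equal row sums that is described by a tuple of subfiles. -/
def Subfiles.entry (x : Subfiles K n A) (k : Fin K) (s : Fin (n + 1)) : A :=
  if h : s = 0 then x.1 - ∑ s', x.2 k s' else x.2 k ⟨s, h⟩

/-- The part of file `m` that is broadcast if the virtual user `(k, s)` demands file `s + q k`. -/
def Subfiles.reduced (x : Subfiles K n A) (q : Fin K → Fin (n + 1)) (m : Fin (n + 1)) :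
    Fin K → {s : Fin (n + 1) // s ≠ 0} → A :=
  fun k s => x.2 k s - if s + q k = m then x.1 else 0

/-- The entry `(k, s)` of the array from which the multiple of the indicator array has been
subtracted. -/
def reducedEntry (y : Fin K → {s : Fin (n + 1) // s ≠ 0} → A) (k : Fin K) (s : Fin (n + 1)) : A :=
  if h : s = 0 then -∑ s', y k s' else y k ⟨s, h⟩

/-- Each row has exactly one `s` with `s + q k = m`, so the indicator array has row sums one.
Subtracting `x.1` times it leaves zero row sums, hence column `0` is recovered from the others. -/
theorem Subfiles.entry_eq (x : Subfiles K n A) (q : Fin K → Fin (n + 1)) (m : Fin (n + 1))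
    (k : Fin K) (s : Fin (n + 1)) :
    x.entry k s = reducedEntry (x.reduced q m) k s + if s + q k = m then x.1 else 0 := by
  unfold Subfiles.entry reducedEntry Subfiles.reduced
  split_ifs with h h1 h1
  · subst h
    rw [zero_add] at h1
    have : ∀ s' : {s : Fin (n + 1) // s ≠ 0}, ¬ (s' : Fin (n + 1)) + q k = m := fun s' hs' =>
      s'.2 (by rw [← h1] at hs'; simpa using hs')
    simp [this]
    abel
  · subst h
    rw [zero_add] at h1
    have hne : m - q k ≠ 0 := fun h => h1 (sub_eq_zero.1 h).symm
    have : ∀ s' : {s : Fin (n + 1) // s ≠ 0},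
        (s' : Fin (n + 1)) + q k = m ↔ s' = ⟨m - q k, hne⟩ := fun s' => by
      rw [Subtype.ext_iff, eq_sub_iff_add_eq]
    simp [this, Finset.sum_sub_distrib]
  · simp
  · simp

/-- Decoding: the cached sum and the broadcast reduced arrays determine the demanded file. -/
theorem Subfiles.decode {x x' : Fin (n + 1) → Subfiles K n A} {q : Fin K → Fin (n + 1)}
    {k : Fin K} {s : Fin (n + 1)}
    (hy : ∀ m, (x m).reduced q m = (x' m).reduced q m)
    (hz : ∑ m, (x m).entry k s = ∑ m, (x' m).entry k s) :
    x (s + q k) = x' (s + q k) := by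
  -- For fixed `(k, s)` the correction term survives only for `m = s + q k`.
  have h1 : (x (s + q k)).1 = (x' (s + q k)).1 := by
    simp_rw [fun m => Subfiles.entry_eq (x m) q m k s, fun m => Subfiles.entry_eq (x' m) q m k s,
      Finset.sum_add_distrib, hy] at hz
    simpa using hz
  refine Prod.ext h1 ?_
  funext j t
  have h2 := congrFun (congrFun (hy (s + q k)) j) t
  unfold Subfiles.reduced at h2
  rw [h1] at h2
  exact sub_left_injective h2

/-- The caching scheme in which user `k` takes the role of a uniformly random virtual user
`(k, s)` and the delivery depends on the demands only through their shifts against these roles. -/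
noncomputable def virtualUserScheme [Fintype A] [Fintype B] (e : Fin (2 ^ F) ≃ Subfiles K n A × B) :
    CachingScheme K (n + 1) F where
  Rand := Fin K → Fin (n + 1)
  Cache := Fin (n + 1) × A
  Msg := (Fin K → Fin (n + 1)) ×
    (Fin (n + 1) → (Fin K → {s : Fin (n + 1) // s ≠ 0} → A) × B)
  randLaw _ := 1 / (n + 1) ^ K
  randLaw_nonneg _ := by positivity
  randLaw_sum := by
    have : ((n : ℝ) + 1) ≠ 0 := by positivity
    simp [this]
  place k S w := (S k, ∑ m, (e (w m)).1.entry k (S k))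
  deliver S w d := (d - S, fun m => ((e (w m)).1.reduced (d - S) m, (e (w m)).2))

variable [Fintype A] [Fintype B] {p : Fin (n + 1) → ℝ} (e : Fin (2 ^ F) ≃ Subfiles K n A × B)

theorem virtualUserScheme_isDecodable : (virtualUserScheme e).IsDecodable p := by
  intro k
  refine condEntropy_eq_zero_of_factors ?_
  rintro ⟨(S : Fin K → Fin (n + 1)), w, d⟩ ⟨(S' : Fin K → Fin (n + 1)), w', d'⟩ h
  simp only [CachingScheme.cacheContent, CachingScheme.demand, CachingScheme.message,
    virtualUserScheme, Prod.mk.injEq] at h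
  obtain ⟨⟨hS, hz⟩, hd, hq, hy⟩ := h
  rw [← hS] at hz
  rw [← hq] at hy
  have hk : S k + (d - S) k = d k := by simp
  have h1 := Subfiles.decode (x := fun m => (e (w m)).1) (x' := fun m => (e (w' m)).1)
    (fun m => (Prod.mk.inj (congrFun hy m)).1) hz
  rw [hk] at h1
  have h2 := (Prod.mk.inj (congrFun hy (d k))).2
  change w (d k) = w' (d' k)
  rw [← hd]
  exact e.injective (Prod.ext h1 h2)

/-- User `k` sees a function of the shifts, its own demand and the files; for fixed demands, `S ↦ d
- S` preserves the uniform law, so these are independent of the other demands. -/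
theorem virtualUserScheme_isPrivate (hp : ∑ i, p i = 1) : (virtualUserScheme e).IsPrivate p := by
  intro k
  refine Indep.condMutualInfo_eq_zero ((virtualUserScheme e).law_sum hp) ?_
    ((virtualUserScheme e).indep_otherDemands_allFiles hp k)
  -- The involution that replaces `S` by `d - S`.
  let σ : (virtualUserScheme e).Sample ≃ (virtualUserScheme e).Sample :=
    { toFun := fun ω => (ω.2.2 - (show Fin K → Fin (n + 1) from ω.1), ω.2.1, ω.2.2)
      invFun := fun ω => (ω.2.2 - (show Fin K → Fin (n + 1) from ω.1), ω.2.1, ω.2.2)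
      left_inv := fun ω => by
        refine Prod.ext ?_ rfl
        exact sub_sub_cancel ω.2.2 (show Fin K → Fin (n + 1) from ω.1)
      right_inv := fun ω => by
        refine Prod.ext ?_ rfl
        exact sub_sub_cancel ω.2.2 (show Fin K → Fin (n + 1) from ω.1) }
  -- Here `t.1` is the shift vector, and the column of user `k` is recovered as `d k - q k`.
  let g : (virtualUserScheme e).Rand × Files (n + 1) F × Fin (n + 1) →
      (Fin (n + 1) × (virtualUserScheme e).Cache × (virtualUserScheme e).Msg) ×
        Files (n + 1) F := fun t =>
    ((t.2.2, (t.2.2 - t.1 k, ∑ m, (e (t.2.1 m)).1.entry k (t.2.2 - t.1 k)),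
      (t.1, fun m => ((e (t.2.1 m)).1.reduced t.1 m, (e (t.2.1 m)).2))), t.2.1)
  have hind := indep_of_equiv_prod (P := (virtualUserScheme e).law p)
    (σ.trans ((virtualUserScheme e).splitDemand k))
    (fun e => ∏ j, p (e j))
    (fun t => (1 / ((n : ℝ) + 1) ^ K) * (∏ _n : Fin (n + 1), (1 / 2 ^ F : ℝ)) * p t.2.2)
    (fun ω => ?_) (sum_prod_demands hp) ?_ g
  · have hg : (fun ω => (((virtualUserScheme e).demand k ω, (virtualUserScheme e).cacheContent k ω,
        (virtualUserScheme e).message ω), (virtualUserScheme e).allFiles ω)) =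
        fun ω => g ((σ.trans ((virtualUserScheme e).splitDemand k)) ω).2 := by
      funext ω
      have hk : ω.2.2 k - (ω.2.2 k - (show Fin K → Fin (n + 1) from ω.1) k) =
          (show Fin K → Fin (n + 1) from ω.1) k := sub_sub_cancel _ _
      change _ = ((_, (ω.2.2 k - (ω.2.2 k - (show Fin K → Fin (n + 1) from ω.1) k),
        ∑ m, (e (ω.2.1 m)).1.entry k
          (ω.2.2 k - (ω.2.2 k - (show Fin K → Fin (n + 1) from ω.1) k))), _), _)
      rw [hk]
      rfl
    rw [hg]
    exact hind
  · rw [CachingScheme.law, prod_demands_split p k]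
    change (1 / ((n : ℝ) + 1) ^ K) * _ * _ = (∏ j : {j : Fin K // j ≠ k}, p (ω.2.2 j)) *
      ((1 / ((n : ℝ) + 1) ^ K) * _ * p (ω.2.2 k))
    ring
  · refine (sum_mul_mul_triple (virtualUserScheme e).randLaw
      (fun _ : Files (n + 1) F => ∏ _n : Fin (n + 1), (1 / 2 ^ F : ℝ)) p).trans ?_
    rw [(virtualUserScheme e).randLaw_sum, sum_uniform_files, hp, one_mul, one_mul]

end Scheme

/-! ### Sizes of caches and messages -/

/-- Splitting files of `F = (K * n + 1) * t + r` bits into `K * n + 1` subfiles of `t` bits and an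
uncoded remainder. -/
theorem exists_private_scheme {K n : ℕ} {p : Fin (n + 1) → ℝ} (hp : ∑ i, p i = 1) (F t : ℕ)
    (ht : (K * n + 1) * t ≤ F) :
    ∃ C : CachingScheme K (n + 1) F, C.IsDecodable p ∧ C.IsPrivate p ∧
      Fintype.card C.Cache = (n + 1) * 2 ^ t ∧
      Fintype.card C.Msg = (n + 1) ^ K * 2 ^ ((n + 1) * (F - t)) := by
  obtain ⟨r, rfl⟩ := Nat.exists_eq_add_of_le ht
  let A := Fin t → ZMod 2
  have hA : Fintype.card A = 2 ^ t := by simp [A]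
  have hs : Fintype.card {s : Fin (n + 1) // s ≠ 0} = n := by simp
  have hcard : Fintype.card (Fin (2 ^ ((K * n + 1) * t + r))) =
      Fintype.card (Subfiles K n A × Fin (2 ^ r)) := by
    simp only [Fintype.card_prod, Fintype.card_fun, Fintype.card_fin, hA, hs]
    rw [← pow_mul, ← pow_mul, ← pow_add, ← pow_add]
    congr 1
    ring
  let e := Fintype.equivOfCardEq hcard
  refine ⟨virtualUserScheme e, virtualUserScheme_isDecodable e, virtualUserScheme_isPrivate e hp,
    ?_, ?_⟩
  · change Fintype.card (Fin (n + 1) × A) = _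
    rw [Fintype.card_prod, Fintype.card_fin, hA]
  · change Fintype.card ((Fin K → Fin (n + 1)) ×
      (Fin (n + 1) → (Fin K → {s : Fin (n + 1) // s ≠ 0} → A) × Fin (2 ^ r))) = _
    simp only [Fintype.card_prod, Fintype.card_fun, Fintype.card_fin, hA, hs]
    rw [← pow_mul, ← pow_mul, ← pow_add, ← pow_mul]
    congr 2
    have : (K * n + 1) * t + r - t = t * n * K + r := by
      rw [Nat.sub_eq_iff_eq_add ((Nat.le_mul_of_pos_left t (Nat.succ_pos _)).trans ht)]
      ring
    rw [this]
    ring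

/-- Coding only part of each file, with subfiles of `⌊M * F⌋` bits, and sending the rest uncoded
costs `N * (F - t)` bits apart from the shifts. This covers all smaller memories without memory
sharing. -/
theorem privatelyAchievable_of_le {K n : ℕ} {p : Fin (n + 1) → ℝ} (hp : ∑ i, p i = 1) {M : ℝ}
    (hM0 : 0 ≤ M) (hM : M * (K * n + 1) ≤ 1) :
    PrivatelyAchievable K (n + 1) p M (((n : ℝ) + 1) * (1 - M)) := by
  intro ε hε
  -- Overheads, using `n + 1 ≤ 2 ^ (n + 1)`: the cached column costs at most `n + 1` bits, the
  -- shifts `(n + 1) * K` bits, and rounding `t` down another `n + 1` bits of message.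
  refine ⟨⌈(((n : ℝ) + 1) * (K + 1)) / ε⌉₊, fun F hF => ?_⟩
  have hFε : ((n : ℝ) + 1) * (K + 1) ≤ ε * F := by
    have := (Nat.le_ceil _).trans (Nat.cast_le (α := ℝ).2 hF)
    rwa [div_le_iff₀ hε, mul_comm (F : ℝ)] at this
  have hMF : 0 ≤ M * F := by positivity
  set t := ⌊M * F⌋₊ with ht
  have ht1 : (t : ℝ) ≤ M * F := Nat.floor_le hMF
  have ht2 : M * F < t + 1 := Nat.lt_floor_add_one _
  have htF : (K * n + 1) * t ≤ F := by
    have hF0 : (0 : ℝ) ≤ F := by positivity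
    have : ((K : ℝ) * n + 1) * t ≤ F := calc
      ((K : ℝ) * n + 1) * t ≤ ((K : ℝ) * n + 1) * (M * F) := by gcongr
      _ = M * (K * n + 1) * F := by ring
      _ ≤ 1 * F := by gcongr
      _ = F := one_mul _
    exact_mod_cast this
  have htF' : t ≤ F := (Nat.le_mul_of_pos_left t (Nat.succ_pos _)).trans htF
  obtain ⟨C, hdec, hpriv, hcache, hmsg⟩ := exists_private_scheme (K := K) hp F t htF
  have hn2 : ((n : ℝ) + 1) ≤ 2 ^ ((n : ℝ) + 1) := by
    have : n + 1 ≤ 2 ^ (n + 1) := Nat.lt_two_pow_self.le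
    have h' : ((n + 1 : ℕ) : ℝ) ≤ (2 : ℝ) ^ ((n + 1 : ℕ) : ℝ) := by
      rw [Real.rpow_natCast]
      exact_mod_cast this
    simpa using h'
  have hK0 : (0 : ℝ) ≤ K := by positivity
  have hn0 : (0 : ℝ) ≤ n := by positivity
  refine ⟨C, hdec, hpriv, ?_, ?_⟩
  · rw [hcache]
    push_cast
    calc ((n : ℝ) + 1) * 2 ^ t ≤ 2 ^ ((n : ℝ) + 1) * 2 ^ (t : ℝ) := by
          rw [Real.rpow_natCast]
          gcongr
      _ = 2 ^ ((n : ℝ) + 1 + t) := (Real.rpow_add two_pos _ _).symm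
      _ ≤ _ := by
          refine Real.rpow_le_rpow_of_exponent_le one_le_two ?_
          nlinarith
  · rw [hmsg]
    push_cast
    calc ((n : ℝ) + 1) ^ K * 2 ^ ((n + 1) * (F - t))
        ≤ (2 ^ ((n : ℝ) + 1)) ^ K * 2 ^ (((n : ℝ) + 1) * (F - t)) := by
          have : (2 : ℝ) ^ ((n + 1) * (F - t)) = 2 ^ (((n : ℝ) + 1) * (F - t)) := by
            rw [← Real.rpow_natCast]
            push_cast [htF']
            rfl
          rw [this]
          gcongr
      _ = 2 ^ (((n : ℝ) + 1) * K + ((n : ℝ) + 1) * (F - t)) := by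
          rw [Real.rpow_add two_pos (((n : ℝ) + 1) * K), Real.rpow_mul_natCast zero_le_two]
      _ ≤ _ := by
          refine Real.rpow_le_rpow_of_exponent_le one_le_two ?_
          nlinarith

end CodedCaching

theorem theorem3 (K N : ℕ) (hK : 1 ≤ K) (hN : 1 ≤ N)
    (p : Fin N → ℝ) (hp_pos : ∀ i, 0 < p i) (hp_sum : ∑ i, p i = 1) :
    CodedCaching.PrivatelyAchievable K N p
      (1 / ((K : ℝ) * ((N : ℝ) - 1) + 1))
      ((N : ℝ) * (1 - 1 / ((K : ℝ) * ((N : ℝ) - 1) + 1))) ∧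
    ((2 ≤ K ∨ N = 1) →
      ∀ M ∈ Set.Icc (0 : ℝ) (1 / ((K : ℝ) * ((N : ℝ) - 1) + 1)),
        CodedCaching.IsOptimalPrivateRate K N p M ((N : ℝ) * (1 - M)) ∧
        ∀ (F : ℕ) (R : ℝ), 1 ≤ F →
          (∃ C : CodedCaching.CachingScheme K N F, C.IsDemandPrivateScheme p M R) →
          (N : ℝ) * (1 - M) ≤ R) := by
  have hach : ∀ M : ℝ, 0 ≤ M → M ≤ 1 / ((K : ℝ) * ((N : ℝ) - 1) + 1) →
      CodedCaching.PrivatelyAchievable K N p M ((N : ℝ) * (1 - M)) := by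
    intro M hM0 hM
    obtain ⟨n, rfl⟩ : ∃ n, N = n + 1 := ⟨N - 1, by omega⟩
    have hcast : ((n + 1 : ℕ) : ℝ) = (n : ℝ) + 1 := by push_cast; rfl
    rw [hcast, add_sub_cancel_right, le_div_iff₀ (by positivity)] at hM
    rw [hcast]
    exact CodedCaching.privatelyAchievable_of_le hp_sum hM0 hM
  have hL : (0 : ℝ) ≤ 1 / ((K : ℝ) * ((N : ℝ) - 1) + 1) := by
    have : (1 : ℝ) ≤ N := by exact_mod_cast hN
    have : (0 : ℝ) ≤ (N : ℝ) - 1 := by linarith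
    positivity
  refine ⟨hach _ hL le_rfl, fun hKN M hM => ⟨⟨hach M hM.1 hM.2, fun R hR => ?_⟩, ?_⟩⟩
  · exact CodedCaching.PrivatelyAchievable.rate_lower_bound hK hp_pos hp_sum hKN hR
  · rintro F R hF ⟨C, hC⟩
    exact C.rate_lower_bound hK hp_pos hp_sum hKN hF hC
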